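/- Let $Z_1,Z_2,\dots$ be independent normal random variables with mean $\mu>0$ and variance $1$, let $S_m=\sum_{i=1}^m Z_i$, let $b>0$, and let \[\tau=\min\{m\ge 1:\ S_m<-b\ \text{or}\ S_m>b\}.\] Let $\Phi$ be the standard normal distribution function, and put $R(a)=\dfrac{\Phi(a)}{1-\Phi(a)}$ and $\Psi(\mu)=1-\dfrac{e^{-\mu^2/2}}{\mu\sqrt{2\pi}\,(1-\Phi(\mu))}$. Then $\mathbb E[\tau]<\infty$, \[\mathbb E[\tau]\ \le\ \frac{e^{2\mu b}R(\mu)-1}{e^{2\mu b}R(\mu)-e^{-2\mu b}}\left(\frac{2b}{\mu}+\frac{e^{-\mu^2/2}}{\mu\sqrt{2\pi}\,\Phi(\mu)}+1\right)-\frac b\mu,\] and \[\mathbb E[\tau]\ \ge\ \frac{e^{2\mu b}-1}{e^{2\mu b}-R(-\mu)e^{-2\mu b}}\left(\frac{2b}{\mu}-\Psi(\mu)\right)-\frac b\mu+\Psi(\mu).\] The last bound also holds with $\frac{2b}{\mu}+\Psi(\mu)$ in place of $\frac{2b}{\mu}-\Psi(\mu)$. -/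

import Mathlib

open MeasureTheory ProbabilityTheory
open scoped ENNReal

namespace GaussianWalk

/-- The standard normal distribution function `Φ`. -/
noncomputable def Phi (x : ℝ) : ℝ := cdf (gaussianReal 0 1) x

/-- `R(a) = Φ(a) / (1 - Φ(a))`. -/
noncomputable def R (a : ℝ) : ℝ := Phi a / (1 - Phi a)

/-- `Ψ(μ) = 1 - exp(-μ²/2) / (μ √(2π) (1 - Φ(μ)))`. -/
noncomputable def Psi (μ : ℝ) : ℝ :=
  1 - Real.exp (-μ ^ 2 / 2) / (μ * Real.sqrt (2 * Real.pi) * (1 - Phi μ))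

/-- The partial sums `S_m = Z_0 + ⋯ + Z_{m-1}` (the sum of the first `m` increments; the
increments are indexed from `0`). -/
def partialSum {Ω : Type*} (Z : ℕ → Ω → ℝ) (m : ℕ) (ω : Ω) : ℝ :=
  ∑ i ∈ Finset.range m, Z i ω

/-- `τ = min {m ≥ 1 : S_m < -b or S_m > b}`, equal to `⊤` if there is no such `m`. -/
noncomputable def exitTime {Ω : Type*} (Z : ℕ → Ω → ℝ) (b : ℝ) : Ω → ℕ∞ :=
  hittingAfter (partialSum Z) {x | x < -b ∨ b < x} 1

/-- The expectation `E[τ]`, as an extended nonnegative number. -/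
noncomputable def expectedExitTime {Ω : Type*} [MeasurableSpace Ω] (P : Measure Ω)
    (Z : ℕ → Ω → ℝ) (b : ℝ) : ℝ≥0∞ :=
  ∫⁻ ω, (exitTime Z b ω : ℝ≥0∞) ∂P

end GaussianWalk

/-! ### Gaussian tilting, reflection and overshoots. -/

namespace GaussianWalk

open Set Filter Topology

/-! The bounds come from Wald's identity `E[S_τ] = μ E[τ]` and from the martingale `exp (-2μ S_n)`,
which gives `E[exp (-2μ S_τ)] = 1`. Let `p` be the probability of leaving upwards. If the walk
stopped exactly at `±b`, both identities would be linear in `p` and would determine `E[τ]`; only the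
overshoot must be controlled.

A walk at `x` in `[-b, b]` exits upwards when its increment exceeds `b - x ≥ 0`. Given this, the
overshoot is stochastically smaller than the increment conditioned to be positive: moving the level
from `0` to `a` multiplies the overshoot density by a multiple of `exp (-a x)`, which decreases, and
Chebyshev's association inequality applies (`setIntegral_overshoot_le`). Reflection treats downward
exits. The extremal overshoots have mean `μ + exp (-μ²/2) / (√(2π) Φ(μ))` upwards and `-μ Ψ(μ)`
downwards, and their exponential moments are `R (-μ)` and `R μ`.

Optional stopping is replaced by telescoping one-step inequalities for the sub-probability laws
`killedLaw` of the walk before exit. Their masses are `P(τ > n)`, so they sum to `E[τ]`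
(`map_restrict_stayEvent`, `expectedExitTime_eq`); `tsum_killedLaw_mass_bounds` passes to the limit
and solves for `p`. -/

lemma integral_exp_mul_gaussianReal (m c : ℝ) :
    ∫ x, Real.exp (c * x) ∂(gaussianReal m 1) = Real.exp (m * c + c ^ 2 / 2) := by
  have h := congrFun (mgf_id_gaussianReal (μ := m) (v := 1)) c
  simpa [mgf] using h

/-- Exponential tilting shifts the mean of a Gaussian measure. -/
lemma gaussianReal_tilted_mul (m c : ℝ) :
    (gaussianReal m 1).tilted (fun x => c * x) = gaussianReal (m + c) 1 := by
  rw [Measure.tilted, integral_exp_mul_gaussianReal, gaussianReal_of_var_ne_zero _ one_ne_zero,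
    gaussianReal_of_var_ne_zero _ one_ne_zero, ← withDensity_mul _ (by fun_prop) (by fun_prop)]
  congr 1
  funext x
  simp only [Pi.mul_apply, gaussianPDF]
  rw [← ENNReal.ofReal_mul (gaussianPDFReal_nonneg _ _ _)]
  congr 1
  simp only [gaussianPDFReal, NNReal.coe_one, mul_one]
  rw [mul_assoc, ← Real.exp_sub, ← Real.exp_add]
  congr 2
  ring

lemma setIntegral_exp_mul_gaussianReal (m c : ℝ) (f : ℝ → ℝ) (s : Set ℝ) :
    ∫ x in s, Real.exp (c * x) * f x ∂(gaussianReal m 1) =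
      Real.exp (m * c + c ^ 2 / 2) * ∫ x in s, f x ∂(gaussianReal (m + c) 1) := by
  rw [← gaussianReal_tilted_mul, setIntegral_tilted, integral_exp_mul_gaussianReal,
    ← integral_const_mul]
  congr 1
  funext x
  rw [smul_eq_mul]
  field_simp

lemma integrable_exp_mul_gaussianReal_iff (m c : ℝ) (f : ℝ → ℝ) :
    Integrable (fun x => Real.exp (c * x) * f x) (gaussianReal m 1) ↔
      Integrable f (gaussianReal (m + c) 1) := by
  rw [← gaussianReal_tilted_mul,
    integrable_tilted_iff (ProbabilityTheory.integrable_exp_mul_gaussianReal c)]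
  rfl

lemma setIntegral_Ioi_comp_sub_gaussianReal (m a : ℝ) (f : ℝ → ℝ) :
    ∫ x in Ioi a, f (x - a) ∂(gaussianReal m 1) =
      ∫ x in Ioi 0, f x ∂(gaussianReal (m - a) 1) := by
  have hemb : MeasurableEmbedding (fun x : ℝ => x - a) := by
    simpa [sub_eq_add_neg] using measurableEmbedding_addRight (-a)
  rw [← gaussianReal_map_sub_const, hemb.setIntegral_map]
  congr 2
  ext x
  simp

/-- Chebyshev's association inequality for a monotone and an antitone function, where the
monotone function attains its mean at `t`. -/
lemma integral_mul_le_of_monotone_antitone {ν : Measure ℝ} [IsFiniteMeasure ν] {h w : ℝ → ℝ}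
    (hh : Monotone h) (hw : Antitone w) {t : ℝ} (ht : h t * ν.real univ = ∫ x, h x ∂ν)
    (ih : Integrable h ν) (iw : Integrable w ν) (ihw : Integrable (fun x => w x * h x) ν) :
    ∫ x, w x * h x ∂ν ≤ h t * ∫ x, w x ∂ν := by
  -- The integrand is `(h x - h t) * (w x - w t)`. Since `h t` is the mean of `h`, the terms
  -- carrying `w t` cancel after integration.
  have key : ∫ x, (w x * h x - h t * w x - w t * h x + h t * w t) ∂ν ≤ 0 := by
    refine integral_nonpos fun x => ?_
    have : (h x - h t) * (w x - w t) ≤ 0 := by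
      rcases le_total x t with hx | hx
      · exact mul_nonpos_of_nonpos_of_nonneg (sub_nonpos.2 (hh hx)) (sub_nonneg.2 (hw hx))
      · exact mul_nonpos_of_nonneg_of_nonpos (sub_nonneg.2 (hh hx)) (sub_nonpos.2 (hw hx))
    simp only [Pi.zero_apply]
    linarith
  rw [integral_add (by fun_prop) (by fun_prop), integral_sub (by fun_prop) (by fun_prop),
    integral_sub (by fun_prop) (by fun_prop), integral_const_mul, integral_const_mul, ← ht,
    integral_const, smul_eq_mul] at key
  linarith

/-- The overshoot of a Gaussian variable over a level `a ≥ 0` is stochastically smaller than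
its overshoot over `0`. -/
lemma setIntegral_overshoot_le (m : ℝ) {a : ℝ} (ha : 0 ≤ a) {h : ℝ → ℝ} (hh : Monotone h) {t : ℝ}
    (ht : h t * (gaussianReal m 1).real (Ioi 0) = ∫ x in Ioi 0, h x ∂(gaussianReal m 1))
    (ih : ∀ m', Integrable h (gaussianReal m' 1)) :
    ∫ x in Ioi a, h (x - a) ∂(gaussianReal m 1) ≤ h t * (gaussianReal m 1).real (Ioi a) := by
  -- Up to a constant, this weight is the density of `gaussianReal (m - a) 1` with respect to
  -- `gaussianReal m 1`; the former is the law of the variable minus `a`.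
  have hw : Antitone (fun x : ℝ => Real.exp (-a * x)) := fun x y hxy =>
    Real.exp_le_exp.2 (by nlinarith)
  have key := integral_mul_le_of_monotone_antitone (ν := (gaussianReal m 1).restrict (Ioi 0)) hh hw
    (t := t) (by simpa [measureReal_restrict_apply] using ht) (ih m).integrableOn
    (ProbabilityTheory.integrable_exp_mul_gaussianReal (-a)).integrableOn
    ((integrable_exp_mul_gaussianReal_iff m (-a) h).2 (ih _)).integrableOn
  have h1 := setIntegral_exp_mul_gaussianReal m (-a) (fun _ => 1) (Ioi 0)
  simp only [mul_one] at h1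
  rw [setIntegral_exp_mul_gaussianReal, h1, ← sub_eq_add_neg,
    ← setIntegral_Ioi_comp_sub_gaussianReal, ← setIntegral_Ioi_comp_sub_gaussianReal,
    mul_left_comm] at key
  simpa using le_of_mul_le_mul_left key (Real.exp_pos _)

lemma gaussianReal_real_Ioi (m : ℝ) : (gaussianReal m 1).real (Ioi 0) = Phi m := by
  have h : gaussianReal m 1 = (gaussianReal 0 1).map (m - ·) := by
    rw [gaussianReal_map_const_sub, sub_zero]
  have := nullSingletonClass_gaussianReal (μ := 0) (v := 1) one_ne_zero
  rw [Phi, cdf_eq_real, h, map_measureReal_apply (by fun_prop) measurableSet_Ioi]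
  have h2 : (fun x => m - x) ⁻¹' Ioi 0 = Iio m := by
    ext x
    simp
  rw [h2]
  exact measureReal_congr Iio_ae_eq_Iic

lemma isOpenPosMeasure_gaussianReal (m : ℝ) : (gaussianReal m 1).IsOpenPosMeasure :=
  (gaussianReal_absolutelyContinuous' m one_ne_zero).isOpenPosMeasure

lemma Phi_pos (m : ℝ) : 0 < Phi m := by
  have := isOpenPosMeasure_gaussianReal m
  rw [← gaussianReal_real_Ioi]
  exact ENNReal.toReal_pos (isOpen_Ioi.measure_pos _ nonempty_Ioi).ne' (measure_ne_top _ _)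

lemma gaussianReal_neg_eq_map (m : ℝ) :
    gaussianReal (-m) 1 = (gaussianReal m 1).map (fun x => -x) := gaussianReal_map_neg.symm

lemma one_sub_Phi (m : ℝ) : 1 - Phi m = Phi (-m) := by
  have := nullSingletonClass_gaussianReal (μ := m) (v := 1) one_ne_zero
  rw [← gaussianReal_real_Ioi m, ← gaussianReal_real_Ioi (-m), gaussianReal_neg_eq_map,
    map_measureReal_apply (by fun_prop) measurableSet_Ioi, ← probReal_compl_eq_one_sub
      measurableSet_Ioi]
  have h2 : (fun x : ℝ => -x) ⁻¹' Ioi 0 = Iio 0 := by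
    ext x
    simp
  rw [h2, compl_Ioi]
  exact measureReal_congr Iio_ae_eq_Iic.symm

lemma R_eq (m : ℝ) : R m = Phi m / Phi (-m) := by
  rw [R, one_sub_Phi]

lemma R_pos (m : ℝ) : 0 < R m := by
  rw [R_eq]
  exact div_pos (Phi_pos _) (Phi_pos _)

lemma integrable_id_gaussianReal (m : ℝ) : Integrable (fun x => x) (gaussianReal m 1) :=
  (memLp_id_gaussianReal 1).integrable le_rfl

/-- Write `x = (x - m) + m`; the density times `x - m` is the derivative of minus the density. -/
lemma setIntegral_Ioi_id_gaussianReal (m : ℝ) :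
    ∫ x in Ioi 0, x ∂(gaussianReal m 1) =
      m * Phi m + Real.exp (-m ^ 2 / 2) / Real.sqrt (2 * Real.pi) := by
  have hsplit : ∫ x in Ioi 0, x ∂(gaussianReal m 1) =
      ∫ x in Ioi 0, (x - m) ∂(gaussianReal m 1) + m * Phi m := by
    rw [integral_sub (integrable_id_gaussianReal m).integrableOn (integrable_const _)]
    simp [gaussianReal_real_Ioi, mul_comm]
  have hpdf : ∫ x in Ioi 0, (x - m) ∂(gaussianReal m 1) =
      ∫ x in Ioi 0, (x - m) * gaussianPDFReal m 1 x := by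
    rw [← integral_indicator measurableSet_Ioi,
      integral_gaussianReal_eq_integral_smul one_ne_zero,
      ← integral_indicator measurableSet_Ioi]
    congr 1
    funext x
    by_cases hx : x ∈ Ioi (0 : ℝ) <;> simp [hx, mul_comm]
  have hderiv : ∀ x ∈ Ici (0 : ℝ), HasDerivAt (fun x => -gaussianPDFReal m 1 x)
      ((x - m) * gaussianPDFReal m 1 x) x := by
    intro x _
    have h1 : HasDerivAt (fun x : ℝ => -(x - m) ^ 2 / 2) (-(x - m)) x := by
      have := (((hasDerivAt_id x).sub_const m).pow 2).neg.div_const 2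
      convert! this using 1
      simp
      ring
    have h2 := (h1.exp.const_mul (Real.sqrt (2 * Real.pi))⁻¹).neg
    convert! h2 using 1
    · funext y
      simp [gaussianPDFReal]
    · simp [gaussianPDFReal]
      ring
  have hint : IntegrableOn (fun x => (x - m) * gaussianPDFReal m 1 x) (Ioi 0) := by
    have h1 : Integrable (fun x => x - m) (gaussianReal m 1) :=
      (integrable_id_gaussianReal m).sub (integrable_const _)
    rw [gaussianReal_of_var_ne_zero _ one_ne_zero, integrable_withDensity_iff_integrable_smul'
      (by fun_prop) (ae_of_all _ fun _ => gaussianPDF_lt_top)] at h1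
    simp only [toReal_gaussianPDF, smul_eq_mul] at h1
    exact (h1.congr (ae_of_all _ fun x => mul_comm _ _)).integrableOn
  have htend : Tendsto (fun x => -gaussianPDFReal m 1 x) atTop (𝓝 0) := by
    have h1 : Tendsto (fun x : ℝ => (x - m) ^ 2 / 2) atTop atTop :=
      ((tendsto_pow_atTop two_ne_zero).comp
        (tendsto_atTop_add_const_right _ (-m) tendsto_id)).atTop_div_const two_pos
    have h2 := ((Real.tendsto_exp_neg_atTop_nhds_zero.comp h1).const_mul
      (Real.sqrt (2 * Real.pi))⁻¹).neg
    simp only [mul_zero, neg_zero] at h2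
    refine h2.congr fun x => ?_
    simp [gaussianPDFReal, neg_div]
  rw [hsplit, hpdf, integral_Ioi_of_hasDerivAt_of_tendsto' hderiv hint htend]
  simp [gaussianPDFReal]
  ring

/-- The mean overshoot over a level `a ≥ 0` is at most the mean overshoot over `0`. -/
lemma setIntegral_overshoot_id_le (m : ℝ) {a : ℝ} (ha : 0 ≤ a) :
    ∫ x in Ioi a, (x - a) ∂(gaussianReal m 1) ≤
      (m + Real.exp (-m ^ 2 / 2) / (Real.sqrt (2 * Real.pi) * Phi m)) *
        (gaussianReal m 1).real (Ioi a) := by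
  refine setIntegral_overshoot_le m ha monotone_id ?_ fun _ => integrable_id_gaussianReal _
  have := Phi_pos m
  simp only [id]
  rw [setIntegral_Ioi_id_gaussianReal, gaussianReal_real_Ioi]
  field_simp

/-- Tilting by `-2m` has normalising constant `1` and turns the mean `m` into `-m`. -/
lemma setIntegral_Ioi_exp_gaussianReal (m : ℝ) :
    ∫ x in Ioi 0, Real.exp (-2 * m * x) ∂(gaussianReal m 1) = Phi (-m) := by
  have h1 := setIntegral_exp_mul_gaussianReal m (-2 * m) (fun _ => 1) (Ioi 0)
  simp only [mul_one] at h1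
  rw [h1, show m * (-2 * m) + (-2 * m) ^ 2 / 2 = 0 by ring, show m + -2 * m = -m by ring]
  simp [gaussianReal_real_Ioi]

/-- Provides the point required by `setIntegral_overshoot_le`: given that the variable is positive,
the exponential has mean `Φ(-m) / Φ(m) = R (-m)`. -/
lemma exists_exp_mul_eq_R_neg {m : ℝ} (hm : m ≠ 0) :
    ∃ t, Real.exp (-2 * m * t) = R (-m) := by
  refine ⟨Real.log (R (-m)) / (-2 * m), ?_⟩
  rw [mul_div_cancel₀ _ (by simpa using hm), Real.exp_log (R_pos _)]

lemma setIntegral_overshoot_exp_le {m : ℝ} (hm : m < 0) {a : ℝ} (ha : 0 ≤ a) :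
    ∫ x in Ioi a, Real.exp (-2 * m * (x - a)) ∂(gaussianReal m 1) ≤
      R (-m) * (gaussianReal m 1).real (Ioi a) := by
  obtain ⟨t, ht⟩ := exists_exp_mul_eq_R_neg hm.ne
  rw [← ht]
  refine setIntegral_overshoot_le m ha (h := fun x => Real.exp (-2 * m * x))
    (fun x y hxy => Real.exp_le_exp.2 (by nlinarith)) ?_
    fun _ => ProbabilityTheory.integrable_exp_mul_gaussianReal _
  have := Phi_pos m
  rw [setIntegral_Ioi_exp_gaussianReal, gaussianReal_real_Ioi, ht, R_eq, neg_neg]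
  field_simp

lemma le_setIntegral_overshoot_exp {m : ℝ} (hm : 0 < m) {a : ℝ} (ha : 0 ≤ a) :
    R (-m) * (gaussianReal m 1).real (Ioi a) ≤
      ∫ x in Ioi a, Real.exp (-2 * m * (x - a)) ∂(gaussianReal m 1) := by
  obtain ⟨t, ht⟩ := exists_exp_mul_eq_R_neg hm.ne'
  have h := setIntegral_overshoot_le m ha (h := fun x => -Real.exp (-2 * m * x)) (t := t)
    (fun x y hxy => neg_le_neg (Real.exp_le_exp.2 (by nlinarith))) ?_
    fun _ => (ProbabilityTheory.integrable_exp_mul_gaussianReal _).neg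
  · rw [integral_neg, ht] at h
    linarith
  have := Phi_pos m
  rw [integral_neg, setIntegral_Ioi_exp_gaussianReal, gaussianReal_real_Ioi, ht, R_eq, neg_neg]
  field_simp

/-- Reflection reduces downward exits to upward exits with the opposite drift. -/
lemma setIntegral_Iio_neg_gaussianReal (m a : ℝ) (f : ℝ → ℝ) :
    ∫ x in Iio (-a), f x ∂(gaussianReal m 1) =
      ∫ x in Ioi a, f (-x) ∂(gaussianReal (-m) 1) := by
  have hemb : MeasurableEmbedding (fun x : ℝ => -x) := (MeasurableEquiv.neg ℝ).measurableEmbedding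
  rw [gaussianReal_neg_eq_map, hemb.setIntegral_map]
  simp only [neg_neg]
  congr 2
  ext x
  simp

lemma gaussianReal_real_Iio_neg (m a : ℝ) :
    (gaussianReal m 1).real (Iio (-a)) = (gaussianReal (-m) 1).real (Ioi a) := by
  simpa using setIntegral_Iio_neg_gaussianReal m a (fun _ => 1)

lemma one_lt_R {m : ℝ} (hm : 0 < m) : 1 < R m := by
  have := isOpenPosMeasure_gaussianReal 0
  have h1 : 0 < (gaussianReal 0 1).real (Ioc (-m) m) :=
    (ENNReal.toReal_pos (isOpen_Ioo.measure_pos _ (nonempty_Ioo.2 (by linarith))).ne'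
      (measure_ne_top _ _)).trans_le (measureReal_mono Ioo_subset_Ioc_self)
  have h2 : (gaussianReal 0 1).real (Iic m) =
      (gaussianReal 0 1).real (Iic (-m)) + (gaussianReal 0 1).real (Ioc (-m) m) := by
    rw [← measureReal_union (Iic_disjoint_Ioc le_rfl) measurableSet_Ioc,
      Iic_union_Ioc_eq_Iic (by linarith)]
  rw [R_eq, one_lt_div (Phi_pos _), Phi, Phi, cdf_eq_real, cdf_eq_real]
  linarith

lemma R_neg_lt_one {m : ℝ} (hm : 0 < m) : R (-m) < 1 := by
  have h := one_lt_R hm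
  have := Phi_pos m
  rw [R_eq, one_lt_div (Phi_pos _)] at h
  rwa [R_eq, neg_neg, div_lt_one this]

/-- `-m Ψ(m) Φ(-m)` is the integral of `x` over the positive half-line under `gaussianReal (-m) 1`.
-/
lemma Psi_neg {m : ℝ} (hm : 0 < m) : Psi m < 0 := by
  have := isOpenPosMeasure_gaussianReal (-m)
  have h : (0:ℝ) < ∫ x in Ioi 0, x ∂(gaussianReal (-m) 1) := by
    have h1 : 0 ≤ᵐ[(gaussianReal (-m) 1).restrict (Ioi 0)] fun x : ℝ => x :=
      (ae_restrict_iff' measurableSet_Ioi).2 (ae_of_all _ fun x hx => le_of_lt hx)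
    rw [setIntegral_pos_iff_support_of_nonneg_ae h1 (integrable_id_gaussianReal _).integrableOn]
    have h2 : Function.support (fun x : ℝ => x) ∩ Ioi 0 = Ioi 0 :=
      inter_eq_right.2 fun x hx => ne_of_gt hx
    rw [h2]
    exact isOpen_Ioi.measure_pos _ nonempty_Ioi
  rw [setIntegral_Ioi_id_gaussianReal, neg_sq] at h
  have := Phi_pos (-m)
  have h2 : 0 < Real.sqrt (2 * Real.pi) := by positivity
  rw [Psi, one_sub_Phi, sub_neg, lt_div_iff₀ (by positivity)]
  have h3 : m * Phi (-m) < Real.exp (-m ^ 2 / 2) / Real.sqrt (2 * Real.pi) := by linarith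
  rw [lt_div_iff₀ h2] at h3
  linarith

end GaussianWalk
-- One step of the walk from a law carried by `[-b, b]`.
namespace GaussianWalk

open Set Filter Topology

section OneStep

variable {μ b : ℝ} {ν : Measure ℝ} [IsFiniteMeasure ν]

lemma integrable_of_ae_mem_Icc (hν : ∀ᵐ x ∂ν, x ∈ Icc (-b) b) {f : ℝ → ℝ} (hf : Continuous f) :
    Integrable f ν := by
  obtain ⟨C, hC⟩ := isCompact_Icc.exists_bound_of_continuousOn (s := Icc (-b) b) hf.continuousOn
  exact Integrable.of_bound hf.aestronglyMeasurable C (hν.mono fun x hx => hC x hx)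

lemma integrable_id_conv (hν : ∀ᵐ x ∂ν, x ∈ Icc (-b) b) :
    Integrable (fun x => x) (ν ∗ gaussianReal μ 1) := by
  rw [Measure.conv, integrable_map_measure (by fun_prop) (by fun_prop)]
  exact ((integrable_of_ae_mem_Icc hν continuous_id).comp_fst _).add
    ((integrable_id_gaussianReal μ).comp_snd _)

lemma integrable_exp_conv (hν : ∀ᵐ x ∂ν, x ∈ Icc (-b) b) (c : ℝ) :
    Integrable (fun x => Real.exp (c * x)) (ν ∗ gaussianReal μ 1) := by
  rw [Measure.conv, integrable_map_measure (by fun_prop) (by fun_prop)]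
  refine ((integrable_of_ae_mem_Icc hν (f := fun x => Real.exp (c * x)) (by fun_prop)).mul_prod
    (integrable_exp_mul_gaussianReal (μ := μ) (v := 1) c)).congr (ae_of_all _ fun x => ?_)
  simp [mul_add, Real.exp_add]

lemma integral_id_conv (hν : ∀ᵐ x ∂ν, x ∈ Icc (-b) b) :
    ∫ x, x ∂(ν ∗ gaussianReal μ 1) = ∫ x, x ∂ν + μ * ν.real univ := by
  rw [integral_conv (integrable_id_conv hν)]
  have h : ∀ x : ℝ, ∫ y, x + y ∂(gaussianReal μ 1) = x + μ := fun x => by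
    rw [integral_add (integrable_const _) (integrable_id_gaussianReal μ)]
    simp
  simp_rw [h]
  rw [integral_add (integrable_of_ae_mem_Icc hν (f := fun x => x) continuous_id)
    (integrable_const _)]
  simp [mul_comm]

/-- This is the martingale property: an increment `Z` satisfies `E[exp (-2μ Z)] = 1`. -/
lemma integral_exp_conv (hν : ∀ᵐ x ∂ν, x ∈ Icc (-b) b) :
    ∫ x, Real.exp (-2 * μ * x) ∂(ν ∗ gaussianReal μ 1) = ∫ x, Real.exp (-2 * μ * x) ∂ν := by
  rw [integral_conv (integrable_exp_conv hν _)]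
  simp_rw [mul_add, Real.exp_add, integral_const_mul, integral_exp_mul_gaussianReal]
  rw [show μ * (-2 * μ) + (-2 * μ) ^ 2 / 2 = 0 by ring, Real.exp_zero]
  simp_rw [mul_one]

/-- By Fubini, an overshoot bound uniform in the starting point survives averaging over that point.
-/
lemma setIntegral_conv_le (hν : ∀ᵐ x ∂ν, x ∈ Icc (-b) b) {γ : Measure ℝ} [IsFiniteMeasure γ]
    {S : Set ℝ} (hS : MeasurableSet S) {f : ℝ → ℝ} (hf : Integrable f (ν ∗ γ)) {K : ℝ}
    (h : ∀ x ∈ Icc (-b) b,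
      ∫ z in (x + ·) ⁻¹' S, f (x + z) ∂γ ≤ K * γ.real ((x + ·) ⁻¹' S)) :
    ∫ x in S, f x ∂(ν ∗ γ) ≤ K * (ν ∗ γ).real S := by
  have hK : K * (ν ∗ γ).real S = ∫ x, S.indicator (fun _ => K) x ∂(ν ∗ γ) := by
    rw [integral_indicator hS]
    simp [mul_comm]
  have hF := hf.indicator hS
  have hG : Integrable (S.indicator (fun _ => K)) (ν ∗ γ) := (integrable_const K).indicator hS
  rw [hK, ← integral_indicator hS, integral_conv hF, integral_conv hG]
  rw [Measure.conv, integrable_map_measure hF.1 (by fun_prop)] at hF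
  rw [Measure.conv, integrable_map_measure hG.1 (by fun_prop)] at hG
  refine integral_mono_ae hF.integral_prod_left hG.integral_prod_left (hν.mono fun x hx => ?_)
  have hpre : MeasurableSet ((x + ·) ⁻¹' S) := (measurable_const_add x) hS
  have h1 : ∀ g : ℝ → ℝ, ∫ z, S.indicator g (x + z) ∂γ = ∫ z in (x + ·) ⁻¹' S, g (x + z) ∂γ :=
    fun g => by
      rw [← integral_indicator hpre]
      rfl
  change ∫ z, S.indicator f (x + z) ∂γ ≤ ∫ z, S.indicator (fun _ => K) (x + z) ∂γ
  rw [h1, h1]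
  simpa [mul_comm] using h x hx

lemma preimage_add_left_Ioi (x c : ℝ) : (x + ·) ⁻¹' Ioi c = Ioi (c - x) := by
  ext z
  simp [sub_lt_iff_lt_add']

lemma preimage_add_left_Iio_neg (x c : ℝ) : (x + ·) ⁻¹' Iio (-c) = Iio (-(c + x)) := by
  ext z
  simp only [mem_preimage, mem_Iio]
  constructor <;> intro h <;> linarith

lemma setIntegral_Ioi_conv_id_le (hν : ∀ᵐ x ∂ν, x ∈ Icc (-b) b) :
    ∫ x in Ioi b, x ∂(ν ∗ gaussianReal μ 1) ≤
      (b + (μ + Real.exp (-μ ^ 2 / 2) / (Real.sqrt (2 * Real.pi) * Phi μ))) *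
        (ν ∗ gaussianReal μ 1).real (Ioi b) := by
  have h := setIntegral_conv_le hν (γ := gaussianReal μ 1) (S := Ioi b) measurableSet_Ioi
    (f := fun x => x - b) ((integrable_id_conv hν).sub (integrable_const _))
    (K := μ + Real.exp (-μ ^ 2 / 2) / (Real.sqrt (2 * Real.pi) * Phi μ)) ?_
  · rw [integral_sub (integrable_id_conv hν).integrableOn (integrable_const _)] at h
    simp only [integral_const, measureReal_restrict_apply_univ, smul_eq_mul] at h
    linarith
  · intro x hx
    rw [preimage_add_left_Ioi]
    convert! setIntegral_overshoot_id_le μ (sub_nonneg.2 hx.2) using 3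
    ring

lemma le_setIntegral_Ioi_conv_id (hν : ∀ᵐ x ∂ν, x ∈ Icc (-b) b) :
    b * (ν ∗ gaussianReal μ 1).real (Ioi b) ≤ ∫ x in Ioi b, x ∂(ν ∗ gaussianReal μ 1) := by
  simpa [mul_comm] using setIntegral_mono_on (integrable_const b).integrableOn
    (integrable_id_conv (μ := μ) hν).integrableOn measurableSet_Ioi fun x hx => le_of_lt hx

lemma le_setIntegral_Iio_conv_id (hν : ∀ᵐ x ∂ν, x ∈ Icc (-b) b) :
    -(b + (-μ + Real.exp (-μ ^ 2 / 2) / (Real.sqrt (2 * Real.pi) * Phi (-μ)))) *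
        (ν ∗ gaussianReal μ 1).real (Iio (-b)) ≤
      ∫ x in Iio (-b), x ∂(ν ∗ gaussianReal μ 1) := by
  have h := setIntegral_conv_le hν (γ := gaussianReal μ 1) (S := Iio (-b)) measurableSet_Iio
    (f := fun x => -b - x) ((integrable_const _).sub (integrable_id_conv hν))
    (K := -μ + Real.exp (-μ ^ 2 / 2) / (Real.sqrt (2 * Real.pi) * Phi (-μ))) ?_
  · rw [integral_sub (integrable_const _) (integrable_id_conv hν).integrableOn] at h
    simp only [integral_const, measureReal_restrict_apply_univ, smul_eq_mul] at h
    linarith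
  · intro x hx
    rw [preimage_add_left_Iio_neg, setIntegral_Iio_neg_gaussianReal, gaussianReal_real_Iio_neg]
    convert! setIntegral_overshoot_id_le (-μ) (a := b + x) (by linarith [hx.1]) using 2
    · funext z
      ring
    · rw [neg_sq]

lemma setIntegral_Iio_conv_id_le (hν : ∀ᵐ x ∂ν, x ∈ Icc (-b) b) :
    ∫ x in Iio (-b), x ∂(ν ∗ gaussianReal μ 1) ≤
      -b * (ν ∗ gaussianReal μ 1).real (Iio (-b)) := by
  simpa [mul_comm] using setIntegral_mono_on (integrable_id_conv (μ := μ) hν).integrableOn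
    (integrable_const (-b)).integrableOn measurableSet_Iio fun x hx => le_of_lt hx

lemma setIntegral_Ioi_conv_exp_le (hμ : 0 < μ) (hν : ∀ᵐ x ∂ν, x ∈ Icc (-b) b) :
    ∫ x in Ioi b, Real.exp (-2 * μ * x) ∂(ν ∗ gaussianReal μ 1) ≤
      Real.exp (-2 * μ * b) * (ν ∗ gaussianReal μ 1).real (Ioi b) := by
  simpa [mul_comm] using setIntegral_mono_on
    (integrable_exp_conv (μ := μ) hν (-2 * μ)).integrableOn
    (integrable_const (Real.exp (-2 * μ * b))).integrableOn measurableSet_Ioi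
    fun x (hx : b < x) => Real.exp_le_exp.2 (by nlinarith)

lemma le_setIntegral_Ioi_conv_exp (hμ : 0 < μ) (hν : ∀ᵐ x ∂ν, x ∈ Icc (-b) b) :
    R (-μ) * Real.exp (-2 * μ * b) * (ν ∗ gaussianReal μ 1).real (Ioi b) ≤
      ∫ x in Ioi b, Real.exp (-2 * μ * x) ∂(ν ∗ gaussianReal μ 1) := by
  have h := setIntegral_conv_le hν (γ := gaussianReal μ 1) (S := Ioi b) measurableSet_Ioi
    (f := fun x => -Real.exp (-2 * μ * x)) (integrable_exp_conv hν _).neg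
    (K := -(R (-μ) * Real.exp (-2 * μ * b))) ?_
  · rw [integral_neg] at h
    linarith
  · intro x hx
    rw [preimage_add_left_Ioi, integral_neg, neg_mul (R (-μ) * _), neg_le_neg_iff]
    have h1 := mul_le_mul_of_nonneg_left
      (le_setIntegral_overshoot_exp hμ (sub_nonneg.2 hx.2)) (Real.exp_pos (-2 * μ * b)).le
    rw [← integral_const_mul] at h1
    simp_rw [← Real.exp_add] at h1
    convert! h1 using 1
    · ring
    · congr! 3
      ring

lemma setIntegral_Iio_conv_exp_le (hμ : 0 < μ) (hν : ∀ᵐ x ∂ν, x ∈ Icc (-b) b) :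
    ∫ x in Iio (-b), Real.exp (-2 * μ * x) ∂(ν ∗ gaussianReal μ 1) ≤
      Real.exp (2 * μ * b) * R μ * (ν ∗ gaussianReal μ 1).real (Iio (-b)) := by
  refine setIntegral_conv_le hν measurableSet_Iio (integrable_exp_conv hν _) ?_
  intro x hx
  rw [preimage_add_left_Iio_neg, setIntegral_Iio_neg_gaussianReal, gaussianReal_real_Iio_neg]
  have h1 := mul_le_mul_of_nonneg_left
    (setIntegral_overshoot_exp_le (neg_lt_zero.2 hμ) (a := b + x) (by linarith [hx.1]))
    (Real.exp_pos (2 * μ * b)).le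
  rw [← integral_const_mul] at h1
  simp_rw [← Real.exp_add] at h1
  rw [neg_neg] at h1
  convert! h1 using 1
  · congr! 3
    ring
  · ring

lemma le_setIntegral_Iio_conv_exp (hμ : 0 < μ) (hν : ∀ᵐ x ∂ν, x ∈ Icc (-b) b) :
    Real.exp (2 * μ * b) * (ν ∗ gaussianReal μ 1).real (Iio (-b)) ≤
      ∫ x in Iio (-b), Real.exp (-2 * μ * x) ∂(ν ∗ gaussianReal μ 1) := by
  simpa [mul_comm] using setIntegral_mono_on
    (integrable_const (Real.exp (2 * μ * b))).integrableOn
    (integrable_exp_conv (μ := μ) hν (-2 * μ)).integrableOn measurableSet_Iio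
    fun x (hx : x < -b) => Real.exp_le_exp.2 (by nlinarith)

lemma integral_eq_add_add (hb : 0 ≤ b) {κ : Measure ℝ} {f : ℝ → ℝ} (hf : Integrable f κ) :
    ∫ x, f x ∂κ = ∫ x in Icc (-b) b, f x ∂κ + ∫ x in Ioi b, f x ∂κ + ∫ x in Iio (-b), f x ∂κ := by
  have h1 : Disjoint (Icc (-b) b) (Ioi b) :=
    disjoint_left.2 fun x hx hx' => not_lt_of_ge hx.2 hx'
  rw [← setIntegral_union h1 measurableSet_Ioi hf.integrableOn hf.integrableOn,
    Icc_union_Ioi_eq_Ici (by linarith), ← compl_Iio, add_comm,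
    integral_add_compl measurableSet_Iio hf]

end OneStep

/-- The law of the walk restricted to the event that it has stayed in `[-b, b]`. -/
noncomputable def killedLaw (μ b : ℝ) : ℕ → Measure ℝ
  | 0 => Measure.dirac 0
  | n + 1 => (killedLaw μ b n ∗ gaussianReal μ 1).restrict (Icc (-b) b)

/-! ### One-step inequalities for the killed walk. -/

section KilledLaw

variable {μ b : ℝ}

instance isFiniteMeasure_killedLaw (n : ℕ) : IsFiniteMeasure (killedLaw μ b n) := by
  induction n with
  | zero => rw [killedLaw]; infer_instance
  | succ n ih => rw [killedLaw]; infer_instance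

lemma ae_killedLaw_mem (hb : 0 ≤ b) (n : ℕ) : ∀ᵐ x ∂(killedLaw μ b n), x ∈ Icc (-b) b := by
  cases n with
  | zero => rw [killedLaw, ae_dirac_eq]; simpa using hb
  | succ n => rw [killedLaw]; exact ae_restrict_mem measurableSet_Icc

/-- The probability of leaving `[-b, b]` upwards at step `n + 1`. -/
noncomputable def exitUp (μ b : ℝ) (n : ℕ) : ℝ :=
  (killedLaw μ b n ∗ gaussianReal μ 1).real (Ioi b)

/-- The probability of leaving `[-b, b]` downwards at step `n + 1`. -/
noncomputable def exitDown (μ b : ℝ) (n : ℕ) : ℝ :=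
  (killedLaw μ b n ∗ gaussianReal μ 1).real (Iio (-b))

lemma killedLaw_mass (hb : 0 ≤ b) (n : ℕ) :
    (killedLaw μ b n).real univ =
      (killedLaw μ b (n + 1)).real univ + exitUp μ b n + exitDown μ b n := by
  have h := integral_eq_add_add hb
    (integrable_const (μ := killedLaw μ b n ∗ gaussianReal μ 1) (1 : ℝ))
  simp only [integral_const, measureReal_restrict_apply_univ, smul_eq_mul, mul_one] at h
  have h2 : (killedLaw μ b n ∗ gaussianReal μ 1).real univ = (killedLaw μ b n).real univ := by
    rw [Measure.conv, map_measureReal_apply (by fun_prop) MeasurableSet.univ, preimage_univ,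
      ← univ_prod_univ, measureReal_prod_prod]
    simp
  rw [killedLaw, measureReal_restrict_apply_univ, exitUp, exitDown, ← h, h2]

lemma killedLaw_mean_le (hb : 0 ≤ b) (n : ℕ) :
    ∫ x, x ∂(killedLaw μ b n) + μ * (killedLaw μ b n).real univ ≤
      ∫ x, x ∂(killedLaw μ b (n + 1)) +
        (b + (μ + Real.exp (-μ ^ 2 / 2) / (Real.sqrt (2 * Real.pi) * Phi μ))) * exitUp μ b n -
        b * exitDown μ b n := by
  have hν := ae_killedLaw_mem (μ := μ) hb n
  rw [← integral_id_conv hν, integral_eq_add_add hb (integrable_id_conv hν)]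
  have h1 := setIntegral_Ioi_conv_id_le (μ := μ) hν
  have h2 := setIntegral_Iio_conv_id_le (μ := μ) hν
  rw [killedLaw, exitUp, exitDown]
  linarith

lemma le_killedLaw_mean (hb : 0 ≤ b) (n : ℕ) :
    ∫ x, x ∂(killedLaw μ b (n + 1)) + b * exitUp μ b n -
        (b + (-μ + Real.exp (-μ ^ 2 / 2) / (Real.sqrt (2 * Real.pi) * Phi (-μ)))) *
          exitDown μ b n ≤
      ∫ x, x ∂(killedLaw μ b n) + μ * (killedLaw μ b n).real univ := by
  have hν := ae_killedLaw_mem (μ := μ) hb n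
  rw [← integral_id_conv hν, integral_eq_add_add hb (integrable_id_conv hν)]
  have h1 := le_setIntegral_Ioi_conv_id (μ := μ) hν
  have h2 := le_setIntegral_Iio_conv_id (μ := μ) hν
  rw [killedLaw, exitUp, exitDown]
  linarith

lemma killedLaw_exp_le (hμ : 0 < μ) (hb : 0 ≤ b) (n : ℕ) :
    ∫ x, Real.exp (-2 * μ * x) ∂(killedLaw μ b n) ≤
      ∫ x, Real.exp (-2 * μ * x) ∂(killedLaw μ b (n + 1)) +
        Real.exp (-2 * μ * b) * exitUp μ b n + Real.exp (2 * μ * b) * R μ * exitDown μ b n := by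
  have hν := ae_killedLaw_mem (μ := μ) hb n
  rw [← integral_exp_conv hν, integral_eq_add_add hb (integrable_exp_conv hν _)]
  have h1 := setIntegral_Ioi_conv_exp_le hμ hν
  have h2 := setIntegral_Iio_conv_exp_le hμ hν
  rw [killedLaw, exitUp, exitDown]
  linarith

lemma le_killedLaw_exp (hμ : 0 < μ) (hb : 0 ≤ b) (n : ℕ) :
    ∫ x, Real.exp (-2 * μ * x) ∂(killedLaw μ b (n + 1)) +
        R (-μ) * Real.exp (-2 * μ * b) * exitUp μ b n +
        Real.exp (2 * μ * b) * exitDown μ b n ≤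
      ∫ x, Real.exp (-2 * μ * x) ∂(killedLaw μ b n) := by
  have hν := ae_killedLaw_mem (μ := μ) hb n
  rw [← integral_exp_conv hν, integral_eq_add_add hb (integrable_exp_conv hν _)]
  have h1 := le_setIntegral_Ioi_conv_exp hμ hν
  have h2 := le_setIntegral_Iio_conv_exp hμ hν
  rw [killedLaw, exitUp, exitDown]
  linarith

end KilledLaw

end GaussianWalk
-- Telescoping, summability and the limiting inequalities.
namespace GaussianWalk

open Set Filter Topology

section Limits

variable {μ b : ℝ}

lemma integral_killedLaw_zero (f : ℝ → ℝ) : ∫ x, f x ∂(killedLaw μ b 0) = f 0 := by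
  rw [killedLaw, integral_dirac]

lemma exitUp_nonneg (n : ℕ) : 0 ≤ exitUp μ b n := measureReal_nonneg

lemma exitDown_nonneg (n : ℕ) : 0 ≤ exitDown μ b n := measureReal_nonneg

lemma killedLaw_mass_sum (hb : 0 ≤ b) (N : ℕ) :
    (killedLaw μ b N).real univ + ∑ n ∈ Finset.range N, exitUp μ b n +
      ∑ n ∈ Finset.range N, exitDown μ b n = 1 := by
  induction N with
  | zero => simp [killedLaw]
  | succ N ih =>
    rw [Finset.sum_range_succ, Finset.sum_range_succ]
    linarith [killedLaw_mass (μ := μ) hb N]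

lemma killedLaw_mean_sum_le (hb : 0 ≤ b) (N : ℕ) :
    μ * ∑ n ∈ Finset.range N, (killedLaw μ b n).real univ ≤
      ∫ x, x ∂(killedLaw μ b N) +
        (b + (μ + Real.exp (-μ ^ 2 / 2) / (Real.sqrt (2 * Real.pi) * Phi μ))) *
          ∑ n ∈ Finset.range N, exitUp μ b n -
        b * ∑ n ∈ Finset.range N, exitDown μ b n := by
  induction N with
  | zero => simp [integral_killedLaw_zero]
  | succ N ih =>
    simp only [Finset.sum_range_succ, mul_add _ (∑ n ∈ _, _)]
    linarith [killedLaw_mean_le (μ := μ) hb N]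

lemma le_killedLaw_mean_sum (hb : 0 ≤ b) (N : ℕ) :
    ∫ x, x ∂(killedLaw μ b N) + b * ∑ n ∈ Finset.range N, exitUp μ b n -
        (b + (-μ + Real.exp (-μ ^ 2 / 2) / (Real.sqrt (2 * Real.pi) * Phi (-μ)))) *
          ∑ n ∈ Finset.range N, exitDown μ b n ≤
      μ * ∑ n ∈ Finset.range N, (killedLaw μ b n).real univ := by
  induction N with
  | zero => simp [integral_killedLaw_zero]
  | succ N ih =>
    simp only [Finset.sum_range_succ, mul_add _ (∑ n ∈ _, _)]
    linarith [le_killedLaw_mean (μ := μ) hb N]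

lemma one_le_killedLaw_exp_sum (hμ : 0 < μ) (hb : 0 ≤ b) (N : ℕ) :
    1 ≤ ∫ x, Real.exp (-2 * μ * x) ∂(killedLaw μ b N) +
      Real.exp (-2 * μ * b) * ∑ n ∈ Finset.range N, exitUp μ b n +
      Real.exp (2 * μ * b) * R μ * ∑ n ∈ Finset.range N, exitDown μ b n := by
  induction N with
  | zero => simp [integral_killedLaw_zero]
  | succ N ih =>
    simp only [Finset.sum_range_succ, mul_add _ (∑ n ∈ _, _)]
    linarith [killedLaw_exp_le hμ hb N]

lemma killedLaw_exp_sum_le_one (hμ : 0 < μ) (hb : 0 ≤ b) (N : ℕ) :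
    ∫ x, Real.exp (-2 * μ * x) ∂(killedLaw μ b N) +
      R (-μ) * Real.exp (-2 * μ * b) * ∑ n ∈ Finset.range N, exitUp μ b n +
      Real.exp (2 * μ * b) * ∑ n ∈ Finset.range N, exitDown μ b n ≤ 1 := by
  induction N with
  | zero => simp [integral_killedLaw_zero]
  | succ N ih =>
    simp only [Finset.sum_range_succ, mul_add _ (∑ n ∈ _, _)]
    linarith [le_killedLaw_exp hμ hb N]

lemma abs_integral_killedLaw_le (hb : 0 ≤ b) {f : ℝ → ℝ} {C : ℝ}
    (hC : ∀ x ∈ Icc (-b) b, |f x| ≤ C) (n : ℕ) :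
    |∫ x, f x ∂(killedLaw μ b n)| ≤ C * (killedLaw μ b n).real univ := by
  rw [← Real.norm_eq_abs]
  exact norm_integral_le_of_norm_le_const ((ae_killedLaw_mem hb n).mono fun x hx => hC x hx)

lemma summable_exitUp (hb : 0 ≤ b) : Summable (exitUp μ b) := by
  refine summable_of_sum_range_le (c := 1) exitUp_nonneg fun N => ?_
  have h := killedLaw_mass_sum (μ := μ) hb N
  have h1 := Finset.sum_nonneg (s := Finset.range N) fun n _ => exitDown_nonneg (μ := μ) (b := b) n
  have h2 := measureReal_nonneg (μ := killedLaw μ b N) (s := univ)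
  linarith

lemma summable_exitDown (hb : 0 ≤ b) : Summable (exitDown μ b) := by
  refine summable_of_sum_range_le (c := 1) exitDown_nonneg fun N => ?_
  have h := killedLaw_mass_sum (μ := μ) hb N
  have h1 := Finset.sum_nonneg (s := Finset.range N) fun n _ => exitUp_nonneg (μ := μ) (b := b) n
  have h2 := measureReal_nonneg (μ := killedLaw μ b N) (s := univ)
  linarith

/-- Positive drift forces summability: the telescoped mean inequality bounds `μ` times each partial
sum by `b + (b + M)`, as the killed mean is at most `b` and the upward exit mass at most `1`. -/
lemma summable_killedLaw_mass (hμ : 0 < μ) (hb : 0 ≤ b) :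
    Summable fun n => (killedLaw μ b n).real univ := by
  set M := μ + Real.exp (-μ ^ 2 / 2) / (Real.sqrt (2 * Real.pi) * Phi μ) with hM
  have hM0 : 0 ≤ M := by
    have := Phi_pos μ
    positivity
  refine summable_of_sum_range_le (c := (b + (b + M)) / μ) (fun n => measureReal_nonneg)
    fun N => ?_
  rw [le_div_iff₀ hμ, mul_comm]
  have h := killedLaw_mass_sum (μ := μ) hb N
  have h0 := Finset.sum_nonneg (s := Finset.range N) fun n _ => exitUp_nonneg (μ := μ) (b := b) n
  have h1 := Finset.sum_nonneg (s := Finset.range N) fun n _ => exitDown_nonneg (μ := μ) (b := b) n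
  have h2 := measureReal_nonneg (μ := killedLaw μ b N) (s := univ)
  have h3 := (abs_le.1 (abs_integral_killedLaw_le (μ := μ) hb (f := fun x => x) (C := b)
    (fun x hx => abs_le.2 hx) N)).2
  have h4 := killedLaw_mean_sum_le (μ := μ) hb N
  rw [← hM] at h4
  have h5 : (b + M) * ∑ n ∈ Finset.range N, exitUp μ b n ≤ (b + M) * 1 :=
    mul_le_mul_of_nonneg_left (by linarith) (by linarith)
  have h6 : b * (killedLaw μ b N).real univ ≤ b * 1 :=
    mul_le_mul_of_nonneg_left (by linarith) hb
  have h7 : 0 ≤ b * ∑ n ∈ Finset.range N, exitDown μ b n := mul_nonneg hb h1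
  linarith

lemma tendsto_integral_killedLaw (hμ : 0 < μ) (hb : 0 ≤ b) {f : ℝ → ℝ} (hf : Continuous f) :
    Tendsto (fun n => ∫ x, f x ∂(killedLaw μ b n)) atTop (𝓝 0) := by
  obtain ⟨C, hC⟩ := isCompact_Icc.exists_bound_of_continuousOn (s := Icc (-b) b) hf.continuousOn
  refine squeeze_zero_norm (fun n => abs_integral_killedLaw_le hb hC n) ?_
  simpa using (summable_killedLaw_mass hμ hb).tendsto_atTop_zero.const_mul C

/-- Bounds on the total mass of the killed laws, which is the expected exit time. -/
lemma tsum_killedLaw_mass_bounds (hμ : 0 < μ) (hb : 0 < b) :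
    ∑' n, (killedLaw μ b n).real univ ≤
      (Real.exp (2 * μ * b) * R μ - 1) / (Real.exp (2 * μ * b) * R μ - Real.exp (-2 * μ * b)) *
        (2 * b / μ + Real.exp (-μ ^ 2 / 2) / (μ * Real.sqrt (2 * Real.pi) * Phi μ) + 1) -
        b / μ ∧
    (Real.exp (2 * μ * b) - 1) / (Real.exp (2 * μ * b) - R (-μ) * Real.exp (-2 * μ * b)) *
        (2 * b / μ - Psi μ) - b / μ + Psi μ ≤ ∑' n, (killedLaw μ b n).real univ := by
  have hT := (summable_killedLaw_mass hμ hb.le).hasSum.tendsto_sum_nat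
  have hp := (summable_exitUp (μ := μ) hb.le).hasSum.tendsto_sum_nat
  have hq := (summable_exitDown (μ := μ) hb.le).hasSum.tendsto_sum_nat
  have ha := (summable_killedLaw_mass hμ hb.le).tendsto_atTop_zero
  have hx := tendsto_integral_killedLaw hμ hb.le (f := fun x => x) continuous_id
  have he := tendsto_integral_killedLaw hμ hb.le (f := fun x => Real.exp (-2 * μ * x))
    (by fun_prop)
  set T := ∑' n, (killedLaw μ b n).real univ
  set p := ∑' n, exitUp μ b n
  set q := ∑' n, exitDown μ b n
  -- The surviving mass tends to `0`, so exit is almost sure.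
  have h0 : 0 + p + q = 1 := tendsto_nhds_unique ((ha.add hp).add hq)
    (tendsto_const_nhds.congr fun N => (killedLaw_mass_sum hb.le N).symm)
  have h1 := le_of_tendsto_of_tendsto' (hT.const_mul μ)
    ((hx.add (hp.const_mul _)).sub (hq.const_mul _)) (killedLaw_mean_sum_le hb.le)
  have h2 := le_of_tendsto_of_tendsto' ((hx.add (hp.const_mul _)).sub (hq.const_mul _))
    (hT.const_mul μ) (le_killedLaw_mean_sum hb.le)
  have h3 := ge_of_tendsto' ((he.add (hp.const_mul _)).add (hq.const_mul _))
    (one_le_killedLaw_exp_sum hμ hb.le)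
  have h4 := le_of_tendsto' ((he.add (hp.const_mul _)).add (hq.const_mul _))
    (killedLaw_exp_sum_le_one hμ hb.le)
  have hqp : q = 1 - p := by linarith
  rw [hqp] at h1 h2 h3 h4
  have hR := one_lt_R hμ
  have hR' := R_neg_lt_one hμ
  have hΨ := Psi_neg hμ
  have hΦ := Phi_pos μ
  have hΦ' := Phi_pos (-μ)
  have e1 : 1 < Real.exp (2 * μ * b) := Real.one_lt_exp_iff.2 (by positivity)
  have e2 : Real.exp (-2 * μ * b) < 1 := Real.exp_lt_one_iff.2 (by nlinarith [mul_pos hμ hb])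
  have e3 : 0 < Real.exp (-2 * μ * b) := Real.exp_pos _
  have hs : 0 < Real.sqrt (2 * Real.pi) := by positivity
  set A := Real.exp (2 * μ * b)
  set B := Real.exp (-2 * μ * b)
  set E := Real.exp (-μ ^ 2 / 2)
  have hE : 0 < E := Real.exp_pos _
  have d1 : 0 < A * R μ - B := by nlinarith
  have d2 : 0 < A - R (-μ) * B := by nlinarith
  -- With `q = 1 - p`, the exponential inequalities `h3` and `h4` are linear in `p` and bound it
  -- from both sides.
  have p1 : p ≤ (A * R μ - 1) / (A * R μ - B) := by
    rw [le_div_iff₀ d1]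
    linarith
  have p2 : (A - 1) / (A - R (-μ) * B) ≤ p := by
    rw [div_le_iff₀ d2]
    linarith
  -- This is how `Ψ` enters: `-μ Ψ(μ)` is the bound on the mean downward overshoot.
  have hΨ' : -μ + E / (Real.sqrt (2 * Real.pi) * Phi (-μ)) = -(μ * Psi μ) := by
    have h5 : μ * Psi μ = μ * (1 - E / (μ * Real.sqrt (2 * Real.pi) * Phi (-μ))) := by
      rw [Psi, one_sub_Phi]
    rw [h5]
    field_simp
    ring
  rw [hΨ'] at h2
  constructor
  · have h5 : T ≤ p * (2 * b / μ + E / (μ * Real.sqrt (2 * Real.pi) * Phi μ) + 1) - b / μ := by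
      rw [← mul_le_mul_iff_right₀ hμ]
      refine h1.trans (le_of_eq ?_)
      field_simp
      ring
    refine h5.trans (sub_le_sub_right (mul_le_mul_of_nonneg_right p1 (by positivity)) _)
  · have h5 : p * (2 * b / μ - Psi μ) - b / μ + Psi μ ≤ T := by
      rw [← mul_le_mul_iff_right₀ hμ]
      refine le_trans (le_of_eq ?_) h2
      field_simp
      ring
    -- The coefficient of `p` must be nonnegative for the lower bound `p2` to be inserted.
    have h6 : 0 ≤ 2 * b / μ - Psi μ := by
      have : 0 < 2 * b / μ := by positivity
      linarith
    have := mul_le_mul_of_nonneg_right p2 h6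
    linarith

end Limits

end GaussianWalk
-- The exit time and the killed laws.
namespace GaussianWalk

open Set Filter Topology

section Walk

variable {Ω : Type*} {Z Z' : ℕ → Ω → ℝ} {b μ : ℝ}

/-- The event that the walk stays in `[-b, b]` during the steps `1, …, n`. -/
def stayEvent (Z : ℕ → Ω → ℝ) (b : ℝ) (n : ℕ) : Set Ω :=
  {ω | ∀ k ∈ Icc 1 n, partialSum Z k ω ∈ Icc (-b) b}

lemma lt_exitTime_iff (n : ℕ) (ω : Ω) : (n : ℕ∞) < exitTime Z b ω ↔ ω ∈ stayEvent Z b n := by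
  rw [← not_le]
  have h : exitTime Z b ω ≤ n ↔ _ := hittingAfter_le_iff
  rw [h]
  simp only [stayEvent, mem_ofPred_eq, not_exists, not_and, not_or, not_lt]
  rfl

/-- Pointwise form of `E[τ] = ∑ P(τ > n)`, valid also for `t = ⊤`. -/
lemma tsum_indicator_lt (t : ℕ∞) :
    ∑' n : ℕ, (if (n : ℕ∞) < t then (1 : ℝ≥0∞) else 0) = (t : ℝ≥0∞) := by
  induction t using ENat.recTopCoe with
  | top => simp
  | coe k =>
    rw [tsum_eq_sum (s := Finset.range k)]
    · rw [Finset.sum_congr rfl fun n hn => if_pos (by exact_mod_cast Finset.mem_range.1 hn)]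
      simp
    · intro n hn
      exact if_neg (by simpa using hn)

lemma coe_exitTime_eq_tsum (ω : Ω) :
    (exitTime Z b ω : ℝ≥0∞) = ∑' n : ℕ, (stayEvent Z b n).indicator 1 ω := by
  classical
  rw [← tsum_indicator_lt]
  refine tsum_congr fun n => ?_
  rw [indicator_apply]
  exact if_congr (lt_exitTime_iff n ω) rfl rfl

lemma stayEvent_succ (n : ℕ) :
    stayEvent Z b (n + 1) = stayEvent Z b n ∩ partialSum Z (n + 1) ⁻¹' Icc (-b) b := by
  ext ω
  simp only [stayEvent, mem_ofPred_eq, mem_inter_iff, mem_preimage]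
  constructor
  · exact fun h => ⟨fun k hk => h k ⟨hk.1, hk.2.trans n.le_succ⟩, h _ ⟨by omega, le_rfl⟩⟩
  · rintro ⟨h1, h2⟩ k hk
    rcases Nat.lt_or_ge n k with h | h
    · rwa [show k = n + 1 from le_antisymm hk.2 h]
    · exact h1 k ⟨hk.1, h⟩

lemma partialSum_succ (n : ℕ) :
    partialSum Z (n + 1) = fun ω => partialSum Z n ω + Z n ω := by
  funext ω
  rw [partialSum, Finset.sum_range_succ, partialSum]

variable [MeasurableSpace Ω] {P : Measure Ω}

lemma measurable_partialSum (hZ : ∀ i, Measurable (Z i)) (n : ℕ) : Measurable (partialSum Z n) :=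
  Finset.measurable_fun_sum _ fun i _ => hZ i

lemma measurableSet_stayEvent (hZ : ∀ i, Measurable (Z i)) (n : ℕ) :
    MeasurableSet (stayEvent Z b n) := by
  induction n with
  | zero =>
    convert! MeasurableSet.univ
    ext ω
    simp [stayEvent]
  | succ n ih =>
    rw [stayEvent_succ]
    exact ih.inter (measurable_partialSum hZ _ measurableSet_Icc)

lemma expectedExitTime_eq_tsum (hZ : ∀ i, Measurable (Z i)) :
    expectedExitTime P Z b = ∑' n, P (stayEvent Z b n) := by
  simp_rw [expectedExitTime, coe_exitTime_eq_tsum]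
  rw [lintegral_tsum fun n =>
    (measurable_one.indicator (measurableSet_stayEvent hZ n)).aemeasurable]
  congr 1
  funext n
  exact lintegral_indicator_one (measurableSet_stayEvent hZ n)

/-- The history of the walk up to time `n`, restricted to an event, is independent of the next
increment. -/
lemma map_restrict_stayEvent_prod [IsProbabilityMeasure P] (hZ : ∀ i, Measurable (Z i))
    (hindep : iIndepFun Z P) (n : ℕ) :
    (P.restrict (stayEvent Z b n)).map (fun ω => (partialSum Z n ω, Z n ω)) =
      ((P.restrict (stayEvent Z b n)).map (partialSum Z n)).prod (P.map (Z n)) := by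
  have := Measure.isProbabilityMeasure_map (hZ n).aemeasurable (μ := P)
  symm
  refine Measure.prod_eq fun s t hs ht => ?_
  have hS := measurable_partialSum hZ n
  rw [Measure.map_apply (hS.prodMk (hZ n)) (hs.prod ht), Measure.map_apply hS hs,
    Measure.map_apply (hZ n) ht, Measure.restrict_apply (hS hs),
    Measure.restrict_apply ((hS.prodMk (hZ n)) (hs.prod ht))]
  have hI := hindep.indepFun_finset (Finset.range n) {n} (by simp) hZ
  -- Extending the first `n` coordinates by `0` gives a walk on the finite product, so the history
  -- event becomes a preimage under the first `n` increments. The added zeros play no role up to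
  -- time `n`.
  let W : ℕ → (Finset.range n → ℝ) → ℝ := fun i x => if h : i ∈ Finset.range n then x ⟨i, h⟩ else 0
  have hW : ∀ i, Measurable (W i) := fun i => by
    by_cases h : i ∈ Finset.range n
    · simp only [W, h, dite_true]
      exact measurable_pi_apply _
    · simp only [W, h, dite_false]
      exact measurable_const
  have hWS : ∀ k ≤ n, ∀ ω, partialSum W k (fun i : Finset.range n => Z i ω) = partialSum Z k ω := by
    intro k hk ω
    refine Finset.sum_congr rfl fun i hi => ?_
    have : i ∈ Finset.range n := Finset.mem_range.2 ((Finset.mem_range.1 hi).trans_le hk)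
    simp only [W, this, dite_true]
  have h1 : partialSum Z n ⁻¹' s ∩ stayEvent Z b n = (fun ω (i : Finset.range n) => Z i ω) ⁻¹'
      (partialSum W n ⁻¹' s ∩ stayEvent W b n) := by
    ext ω
    simp only [mem_inter_iff, mem_preimage, hWS n le_rfl, stayEvent, mem_ofPred_eq]
    refine and_congr_right fun _ => forall₂_congr fun k hk => ?_
    rw [hWS k hk.2]
  have h2 : Z n ⁻¹' t = (fun ω (i : ({n} : Finset ℕ)) => Z i ω) ⁻¹'
      ((fun x => x ⟨n, by simp⟩) ⁻¹' t) := rfl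
  have h3 : (fun ω => (partialSum Z n ω, Z n ω)) ⁻¹' s ×ˢ t ∩ stayEvent Z b n =
      (partialSum Z n ⁻¹' s ∩ stayEvent Z b n) ∩ Z n ⁻¹' t := by
    ext ω
    simp only [mem_inter_iff, mem_preimage, mem_prod]
    tauto
  rw [h3, h1, h2]
  exact hI.measure_inter_preimage_eq_mul _ _
    ((measurable_partialSum hW n hs).inter (measurableSet_stayEvent hW n))
    (measurable_pi_apply _ ht)

/-- Each step adds an increment independent of the past, which convolves the law, and then imposes
the constraint of staying in `[-b, b]`, which restricts it. -/
lemma map_restrict_stayEvent [IsProbabilityMeasure P] (hZ : ∀ i, Measurable (Z i))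
    (hlaw : ∀ i, P.map (Z i) = gaussianReal μ 1) (hindep : iIndepFun Z P) (n : ℕ) :
    (P.restrict (stayEvent Z b n)).map (partialSum Z n) = killedLaw μ b n := by
  induction n with
  | zero =>
    have h1 : stayEvent Z b 0 = univ := by
      ext ω
      simp [stayEvent]
    have h2 : partialSum Z 0 = fun _ => 0 := by
      funext ω
      simp [partialSum]
    rw [h1, h2, Measure.restrict_univ, Measure.map_const, measure_univ, one_smul, killedLaw]
  | succ n ih =>
    have hS := measurable_partialSum hZ (n + 1)
    rw [killedLaw, ← ih, ← hlaw n, Measure.conv, ← map_restrict_stayEvent_prod hZ hindep,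
      Measure.map_map (by fun_prop) ((measurable_partialSum hZ n).prodMk (hZ n)), stayEvent_succ,
      inter_comm, ← Measure.restrict_restrict (hS measurableSet_Icc),
      ← Measure.restrict_map hS measurableSet_Icc, partialSum_succ]
    rfl

lemma expectedExitTime_eq [IsProbabilityMeasure P] (hZ : ∀ i, Measurable (Z i))
    (hlaw : ∀ i, P.map (Z i) = gaussianReal μ 1) (hindep : iIndepFun Z P)
    (hμ : 0 < μ) (hb : 0 ≤ b) :
    expectedExitTime P Z b = ENNReal.ofReal (∑' n, (killedLaw μ b n).real univ) := by
  rw [expectedExitTime_eq_tsum hZ, ENNReal.ofReal_tsum_of_nonneg (fun _ => measureReal_nonneg)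
    (summable_killedLaw_mass hμ hb)]
  congr 1
  funext n
  rw [ofReal_measureReal, ← map_restrict_stayEvent hZ hlaw hindep,
    Measure.map_apply (measurable_partialSum hZ n) MeasurableSet.univ, preimage_univ,
    Measure.restrict_apply_univ]

lemma expectedExitTime_congr (h : ∀ i, Z i =ᵐ[P] Z' i) :
    expectedExitTime P Z b = expectedExitTime P Z' b := by
  refine lintegral_congr_ae ((ae_all_iff.2 h).mono fun ω hω => ?_)
  have h1 : ∀ n, partialSum Z n ω = partialSum Z' n ω := fun n =>
    Finset.sum_congr rfl fun i _ => hω i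
  beta_reduce
  rw [coe_exitTime_eq_tsum, coe_exitTime_eq_tsum]
  refine tsum_congr fun n => indicator_eq_indicator ?_ rfl
  simp only [stayEvent, mem_ofPred_eq, h1]

end Walk

end GaussianWalk
/-- Bounds on the expected exit time of the Gaussian walk with positive drift `μ` from `[-b, b]`.
The second lower bound is the first one with the sign of `Ψ(μ)` in the parenthesis reversed. -/
theorem mainTheorem5 {Ω : Type*} [MeasurableSpace Ω] (P : Measure Ω) [IsProbabilityMeasure P]
    (μ b : ℝ) (hμ : 0 < μ) (hb : 0 < b) (Z : ℕ → Ω → ℝ)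
    (hlaw : ∀ i, HasLaw (Z i) (gaussianReal μ 1) P) (hindep : iIndepFun Z P) :
    GaussianWalk.expectedExitTime P Z b ≠ ⊤ ∧
    (GaussianWalk.expectedExitTime P Z b).toReal ≤
      (Real.exp (2 * μ * b) * GaussianWalk.R μ - 1) /
          (Real.exp (2 * μ * b) * GaussianWalk.R μ - Real.exp (-2 * μ * b)) *
        (2 * b / μ +
          Real.exp (-μ ^ 2 / 2) / (μ * Real.sqrt (2 * Real.pi) * GaussianWalk.Phi μ) + 1) -
        b / μ ∧
    (Real.exp (2 * μ * b) - 1) /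
          (Real.exp (2 * μ * b) - GaussianWalk.R (-μ) * Real.exp (-2 * μ * b)) *
        (2 * b / μ - GaussianWalk.Psi μ) - b / μ + GaussianWalk.Psi μ ≤
      (GaussianWalk.expectedExitTime P Z b).toReal ∧
    (Real.exp (2 * μ * b) - 1) /
          (Real.exp (2 * μ * b) - GaussianWalk.R (-μ) * Real.exp (-2 * μ * b)) *
        (2 * b / μ + GaussianWalk.Psi μ) - b / μ + GaussianWalk.Psi μ ≤
      (GaussianWalk.expectedExitTime P Z b).toReal := by

  -- `HasLaw` gives only almost everywhere measurability; measurable versions leave the expected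
  -- exit time unchanged.
  let Z' : ℕ → Ω → ℝ := fun i => (hlaw i).aemeasurable.mk (Z i)
  have hZZ' : ∀ i, Z i =ᵐ[P] Z' i := fun i => (hlaw i).aemeasurable.ae_eq_mk
  have hT := GaussianWalk.expectedExitTime_congr (b := b) hZZ'
  rw [GaussianWalk.expectedExitTime_eq (Z := Z') (fun i => (hlaw i).aemeasurable.measurable_mk)
    (fun i => (Measure.map_congr (hZZ' i)).symm.trans (hlaw i).map_eq) (hindep.congr hZZ') hμ
    hb.le] at hT
  obtain ⟨hU, hL⟩ := GaussianWalk.tsum_killedLaw_mass_bounds hμ hb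
  rw [hT, ENNReal.toReal_ofReal (tsum_nonneg fun _ => measureReal_nonneg)]
  refine ⟨ENNReal.ofReal_ne_top, hU, hL, le_trans ?_ hL⟩
  -- The remaining bound is weaker than `hL`: `Ψ(μ) < 0` and the prefactor is nonnegative.
  have hΨ := GaussianWalk.Psi_neg hμ
  have e1 : 1 < Real.exp (2 * μ * b) := Real.one_lt_exp_iff.2 (by positivity)
  have e2 : Real.exp (-2 * μ * b) < 1 := Real.exp_lt_one_iff.2 (by nlinarith [mul_pos hμ hb])
  have hR := GaussianWalk.R_neg_lt_one hμ
  have hc : 0 ≤ (Real.exp (2 * μ * b) - 1) /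
      (Real.exp (2 * μ * b) - GaussianWalk.R (-μ) * Real.exp (-2 * μ * b)) :=
    div_nonneg (by linarith) (by nlinarith [Real.exp_pos (-2 * μ * b)])
  have := mul_le_mul_of_nonneg_left
    (show 2 * b / μ + GaussianWalk.Psi μ ≤ 2 * b / μ - GaussianWalk.Psi μ by linarith) hc
  linarith
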